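/- The $1$-dimensional game of Rugby with $m$ cops is played on $\mathbb{Z}\times[n]$, where $[n]=\{1,\dots,n\}$ and distance is given by the $\ell_\infty$ metric. The cops first choose their starting positions. The robber is then placed at $(-C,n)$, where $C\in\mathbb{Z}$ is any integer such that his first coordinate is at least $2n$ less than that of every cop. After that the two sides move alternately with perfect information, the cops going first: on the cops' turn each cop moves to a vertex at distance at most $1$ from her current vertex, and on his turn the robber moves to a vertex at distance at most $2$ from his current vertex. The robber is caught as soon as some cop is on the same vertex as he is. The cops win if they have starting positions, a strategy and some $k>0$ such that, for every admissible $C$ and whatever the robber does, he never passes $\{k\}\times[n]$ (that is, never reaches a first coordinate greater than $k$) without having been caught. **Theorem 3.2.** $O(n^{0.999})$ cops can win the $1$-dimensional game of Rugby: there is a constant $K$ such that for every $n\ge 1$ there is an $m\le K n^{0.999}$ such that $m$ cops can win the game on $\mathbb{Z}\times[n]$. -/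

import Mathlib

namespace Rugby

/-- A lattice point `(x, y)`. -/
abbrev Pos := ℤ × ℤ

/-- The tunnel `ℤ × [n]`, where `[n] = {1, …, n}`. -/
def tunnel (n : ℕ) : Set Pos := {p | 1 ≤ p.2 ∧ p.2 ≤ (n : ℤ)}

/-- The `ℓ_∞` distance on lattice points. -/
def linfDist (p q : Pos) : ℤ := max |p.1 - q.1| |p.2 - q.2|

/-- `r 0, r 1, r 2, …` is a sequence of positions that the robber may follow in the tunnel
`ℤ × [n]`: he starts at `(-C, n)`, stays in the tunnel and moves a distance at most `2` each turn. -/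
structure IsRobberPath (n : ℕ) (C : ℤ) (r : ℕ → Pos) : Prop where
  start : r 0 = (-C, (n : ℤ))
  mem : ∀ t, r t ∈ tunnel n
  step : ∀ t, linfDist (r t) (r (t + 1)) ≤ 2

/-- The positions of `m` cops after their first `t` turns, if they begin at `c₀` and play the
strategy `σ` against a robber whose successive positions are `r 0, r 1, …`. The order of play is:
the cops take their places, the robber takes his place `r 0`, and then the cops and the robber move
alternately, the cops going first. So on turn `t + 1` the cops know exactly `r 0, …, r t`. (Their
own previous positions are determined by `c₀`, `σ` and the robber's previous positions.) -/
def copsAt {m : ℕ} (c₀ : Fin m → Pos) (σ : List Pos → Fin m → Pos) (r : ℕ → Pos) :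
    ℕ → Fin m → Pos
  | 0 => c₀
  | t + 1 => σ ((List.range (t + 1)).map r)

/-- `m` cops with trajectory `c` are legally placed: they stay in the tunnel and each of them moves
a distance at most `1` on each turn. -/
structure IsCopsPath (n : ℕ) {m : ℕ} (c : ℕ → Fin m → Pos) : Prop where
  mem : ∀ t i, c t i ∈ tunnel n
  step : ∀ t i, linfDist (c t i) (c (t + 1) i) ≤ 1

/-- Some cop has been on top of the robber by the end of the robber's `t`-th turn. The positions
that occur are, in order, `c 0, r 0, c 1, r 1, …, c t, r t`, so the robber at `r s` meets a cop
either upon his own arrival (a cop of `c s`) or after the following turn of the cops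
(a cop of `c (s + 1)`). -/
def CaughtBy {m : ℕ} (c : ℕ → Fin m → Pos) (r : ℕ → Pos) (t : ℕ) : Prop :=
  (∃ s ≤ t, ∃ i, c s i = r s) ∨ (∃ s < t, ∃ i, c (s + 1) i = r s)

/-- `m` cops can win the game of Rugby on `ℤ × [n]` against a robber of speed `2`. The robber wins
if for every `k > 0` he can pass the plane `{k} × [n]` without a cop ever having been on top of him.
The cops win if they have an initial placement `c₀`, a strategy `σ` and some `k > 0` such that,
wherever the robber starts on the line `y = n` at horizontal distance at least `2 n` to the left of
all the cops and however he moves, he never is beyond `{k} × [n]` without having been caught. -/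
def CopsWin (n m : ℕ) : Prop :=
  ∃ (c₀ : Fin m → Pos) (σ : List Pos → Fin m → Pos) (k : ℤ), 0 < k ∧
    ∀ (C : ℤ), (∀ i, -C + 2 * (n : ℤ) ≤ (c₀ i).1) →
      ∀ r : ℕ → Pos, IsRobberPath n C r →
        IsCopsPath n (copsAt c₀ σ r) ∧
          ∀ t, k < (r t).1 → CaughtBy (copsAt c₀ σ r) r t

end Rugby

namespace Rugby


/-! Rotated by 45°, the `ℓ_∞` game becomes an `ℓ₁` game with speeds 4 and 2, and the cops defend a
thick diagonal strip that the robber must enter. A barrier (`IsFaceCover`) is split into sets, each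
served by one cop: two points of one set must lie at least twice as far apart for a robber avoiding
the barrier as in the plain metric.

Such barriers are built recursively. A strip of length `32 * L` is cut into 32 copies of a barrier
of length `L`, and a wall of height `7 * L`, made of 14 more copies, is erected in the middle. The
wall costs 14 copies, but the detours it forces let 10 pairs of base copies and 5 pairs of wall
copies share guards, leaving 46 - 15 = 31 groups (`subdivide_far`). So length grows by 32 and the
number of guards by 31 (`exists_isFaceCover`), giving exponent log 31 / log 32 < 0.999.

One cop can serve a set by a Lipschitz extension (`guardCoord`): her position is a function of the
robber's that changes by at most 1 per coordinate at each of his moves, and that brings her within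
reach of any point of the set he steps onto (`exists_guarding_strategy`). -/

/-! ### Face covers and the walled face -/

/-- The `ℓ₁` distance on `ℤ × ℤ`. -/
def l1Dist (p q : ℤ × ℤ) : ℤ := |p.1 - q.1| + |p.2 - q.2|

lemma l1Dist_le_iff {p q : ℤ × ℤ} {c : ℤ} :
    l1Dist p q ≤ c ↔ (p.1 - q.1 + (p.2 - q.2) ≤ c ∧ p.1 - q.1 - (p.2 - q.2) ≤ c ∧
      -(p.1 - q.1) + (p.2 - q.2) ≤ c ∧ -(p.1 - q.1) - (p.2 - q.2) ≤ c) := by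
  unfold l1Dist
  rcases abs_cases (p.1 - q.1) with h | h <;> rcases abs_cases (p.2 - q.2) with h' | h' <;>
    rw [h.1, h'.1] <;> constructor <;> intro H <;> omega

lemma l1Dist_comm (p q : ℤ × ℤ) : l1Dist p q = l1Dist q p := by
  unfold l1Dist
  rw [abs_sub_comm, abs_sub_comm p.2]

lemma l1Dist_walk {z : ℕ → ℤ × ℤ} {k : ℕ} (hz : ∀ t < k, l1Dist (z t) (z (t + 1)) ≤ 4)
    (s d : ℕ) (h : s + d ≤ k) : l1Dist (z s) (z (s + d)) ≤ 4 * d := by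
  induction d with
  | zero => simp [l1Dist]
  | succ d ih =>
    have h1 := l1Dist_le_iff.1 (ih (by omega))
    have h2 := l1Dist_le_iff.1 (hz (s + d) (by omega))
    rw [l1Dist_le_iff, ← add_assoc]
    push_cast
    omega

/-- The strip of thickness `4` behind the base of a face of length `L`. -/
def backing (L : ℤ) : Set (ℤ × ℤ) := {p | 0 ≤ p.1 ∧ p.1 < L ∧ -4 ≤ p.2 ∧ p.2 ≤ -1}

/-- The sets `A i` form a barrier containing a base segment of length `L` and thickness `4`. It is
approached from above, and two points of the same `A i` are so far apart for an intruder of `ℓ₁`-speed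
`4` who avoids the barrier that a guard of speed `2` can serve both. -/
structure IsFaceCover (L : ℤ) {N : ℕ} (A : Fin N → Set (ℤ × ℤ)) : Prop where
  box : ∀ i, ∀ p ∈ A i, 0 ≤ p.1 ∧ p.1 < L ∧ 0 ≤ p.2 ∧ p.2 < L
  base : ∀ p : ℤ × ℤ, 0 ≤ p.1 → p.1 < L → 0 ≤ p.2 → p.2 ≤ 3 → ∃ i, p ∈ A i
  far : ∀ i, ∀ k : ℕ, 2 ≤ k → ∀ z : ℕ → ℤ × ℤ, z 0 ∈ A i → z k ∈ A i →
    (∀ t < k, l1Dist (z t) (z (t + 1)) ≤ 4) →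
    (∀ t, 0 < t → t < k → (∀ j, z t ∉ A j) ∧ z t ∉ backing L) → l1Dist (z 0) (z k) ≤ 2 * k

/-- One guard per lattice point of the 4 × 4 box; each set is a singleton, so separation is trivial.
-/
lemma exists_isFaceCover_four : ∃ A : Fin 16 → Set (ℤ × ℤ), IsFaceCover 4 A := by
  refine ⟨fun i => {p | p.1 = ((i : ℕ) / 4 : ℕ) ∧ p.2 = ((i : ℕ) % 4 : ℕ)}, ?_, ?_, ?_⟩
  · rintro i p ⟨h1, h2⟩
    omega
  · intro p h1 h2 h3 h4
    refine ⟨⟨4 * p.1.toNat + p.2.toNat, by omega⟩, ?_, ?_⟩ <;> dsimp only <;> omega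
  · rintro i k - z ⟨h1, h2⟩ ⟨h3, h4⟩ - -
    rw [l1Dist_le_iff]
    omega

/-- The pieces of a face: `32` base pieces, and `7` pieces on either side of a wall that is erected
in the middle of the base. -/
inductive Piece
  | base (k : Fin 32)
  | left (k : Fin 7)
  | right (k : Fin 7)

/-- The coordinates of a point with respect to a piece of length `L`. -/
def Piece.chart (L : ℤ) : Piece → ℤ × ℤ → ℤ × ℤ
  | base k, p => (p.1 - (k : ℕ) * L, p.2)
  | left k, p => (p.2 - (k : ℕ) * L, 16 * L - 1 - p.1)
  | right k, p => ((k : ℕ) * L + L - 1 - p.2, p.1 - 16 * L)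

/-- Pieces with the same number share their guards. -/
def Piece.group : Piece → ℕ
  | base k => if (k : ℕ) < 16 then k else k - 10
  | left k => 22 + k
  | right k => if (k : ℕ) < 5 then 22 + k else 24 + k

lemma Piece.group_lt (a : Piece) : a.group < 31 := by
  cases a <;> simp only [Piece.group] <;> (try split_ifs) <;> omega

lemma Piece.l1Dist_chart (L : ℤ) (a : Piece) (p q : ℤ × ℤ) :
    l1Dist (a.chart L p) (a.chart L q) = l1Dist p q := by
  cases a <;> simp only [Piece.chart, l1Dist]
  · congr 2; ring
  · rw [add_comm, abs_sub_comm p.1]; congr 2 <;> ring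
  · rw [add_comm, abs_sub_comm p.2]; congr 2 <;> ring

/-- Whoever crosses the wall either leaves the space above the face or passes above the wall. -/
lemma exists_detour {L : ℤ} {k : ℕ} (hk : 2 ≤ k) {z : ℕ → ℤ × ℤ} (h0 : 0 ≤ (z 0).2)
    (hl : (z 0).1 < 16 * L) (hr : 16 * L ≤ (z k).1)
    (hz : ∀ t < k, l1Dist (z t) (z (t + 1)) ≤ 4)
    (hbase : ∀ t, 0 < t → t < k → ¬ (0 ≤ (z t).1 ∧ (z t).1 < 32 * L ∧ -4 ≤ (z t).2 ∧ (z t).2 ≤ 3))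
    (hwall : ∀ t, 0 < t → t < k → ¬ (16 * L - 4 ≤ (z t).1 ∧ (z t).1 < 16 * L + 4 ∧
      0 ≤ (z t).2 ∧ (z t).2 < 7 * L)) :
    ∃ t, 0 < t ∧ t < k ∧ ((z t).1 < 0 ∨ 32 * L ≤ (z t).1 ∨ 7 * L ≤ (z t).2) := by
  by_contra! H
  -- Base and backing together are 8 thick: even from height 0 a step of length 4 cannot jump below
  -- them.
  have hpos : ∀ t, 0 < t → t < k → 4 ≤ (z t).2 := by
    intro t ht
    induction t, ht using Nat.le_induction with
    | base =>
      intro h1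
      have a := l1Dist_le_iff.1 (hz 0 (by omega))
      have b := H 1 (by omega) h1
      have c := hbase 1 (by omega) h1
      rw [zero_add] at a
      change 4 ≤ (z 1).2
      omega
    | succ t ht ih =>
      intro h1
      have a := l1Dist_le_iff.1 (hz t (by omega))
      have b := H (t + 1) (by omega) h1
      have c := hbase (t + 1) (by omega) h1
      have d := ih (by omega)
      omega
  classical
  have hex : ∃ t, 16 * L ≤ (z t).1 := ⟨k, hr⟩
  obtain ⟨T, hT⟩ : ∃ T, T = Nat.find hex := ⟨_, rfl⟩
  have h1 : 16 * L ≤ (z T).1 := hT ▸ Nat.find_spec hex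
  have h2 : T ≤ k := hT ▸ Nat.find_min' hex hr
  have h3 : T ≠ 0 := by rintro rfl; omega
  obtain ⟨S, rfl⟩ := Nat.exists_eq_succ_of_ne_zero h3
  have h4 : ¬ 16 * L ≤ (z S).1 := Nat.find_min hex (by omega)
  have a := l1Dist_le_iff.1 (hz S (by omega))
  rw [Nat.succ_eq_add_one] at *
  -- At the first crossing of the wall, one of the two points around it is interior to the walk, as
  -- `2 ≤ k`, and lies within 4 of the middle line.
  rcases h2.lt_or_eq with h5 | h5
  · have b := H (S + 1) (by omega) h5
    have c := hwall (S + 1) (by omega) h5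
    have d := hpos (S + 1) (by omega) h5
    omega
  · have b := H S (by omega) (by omega)
    have c := hwall S (by omega) (by omega)
    have d := hpos S (by omega) (by omega)
    omega


/-! ### The recursive step -/

/-- The sets of a subdivided face, in terms of those of its pieces. -/
def subdivide (L : ℤ) {N : ℕ} (A : Fin N → Set (ℤ × ℤ)) (x : Fin 31 × Fin N) : Set (ℤ × ℤ) :=
  {p | ∃ a : Piece, a.group = x.1 ∧ a.chart L p ∈ A x.2}

section subdivide

variable {L : ℤ} {N : ℕ} {A : Fin N → Set (ℤ × ℤ)}

lemma mem_subdivide_of_chart {p : ℤ × ℤ} (a : Piece) {i : Fin N} (h : a.chart L p ∈ A i) :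
    p ∈ subdivide L A (⟨a.group, a.group_lt⟩, i) := ⟨a, rfl, h⟩

lemma subdivide_box (hA : IsFaceCover L A) {x : Fin 31 × Fin N} {p : ℤ × ℤ}
    (hp : p ∈ subdivide L A x) : 0 ≤ p.1 ∧ p.1 < 32 * L ∧ 0 ≤ p.2 ∧ p.2 < 32 * L := by
  obtain ⟨a, -, ha⟩ := hp
  have h := hA.box _ _ ha
  have hL : 0 < L := by omega
  cases a with
  | base k =>
    have h1 : ((k : ℕ) : ℤ) * L ≤ 31 * L := mul_le_mul_of_nonneg_right (by omega) hL.le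
    have h2 : 0 ≤ ((k : ℕ) : ℤ) * L := by positivity
    simp only [Piece.chart] at h
    omega
  | left k =>
    have h1 : ((k : ℕ) : ℤ) * L ≤ 6 * L := mul_le_mul_of_nonneg_right (by omega) hL.le
    have h2 : 0 ≤ ((k : ℕ) : ℤ) * L := by positivity
    simp only [Piece.chart] at h
    omega
  | right k =>
    have h1 : ((k : ℕ) : ℤ) * L ≤ 6 * L := mul_le_mul_of_nonneg_right (by omega) hL.le
    have h2 : 0 ≤ ((k : ℕ) : ℤ) * L := by positivity
    simp only [Piece.chart] at h
    omega

lemma exists_chart_index (hL : 0 < L) {m : ℕ} {x : ℤ} (h0 : 0 ≤ x) (h1 : x < m * L) :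
    ∃ k : Fin m, 0 ≤ x - (k : ℕ) * L ∧ x - (k : ℕ) * L < L := by
  have h2 : 0 ≤ x / L := Int.ediv_nonneg h0 hL.le
  have h3 : x / L < m := Int.ediv_lt_of_lt_mul hL h1
  refine ⟨⟨(x / L).toNat, by omega⟩, ?_⟩
  have h4 := Int.emod_add_mul_ediv x L
  have h5 := Int.emod_nonneg x hL.ne'
  have h6 := Int.emod_lt_of_pos x hL
  have h7 : (((x / L).toNat : ℕ) : ℤ) = x / L := Int.toNat_of_nonneg h2
  dsimp only
  rw [h7, mul_comm]
  omega

lemma subdivide_base (hL : 0 < L) (hA : IsFaceCover L A) {p : ℤ × ℤ} (h0 : 0 ≤ p.1)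
    (h1 : p.1 < 32 * L) (h2 : 0 ≤ p.2) (h3 : p.2 ≤ 3) : ∃ x, p ∈ subdivide L A x := by
  obtain ⟨k, hk, hk'⟩ := exists_chart_index hL (m := 32) h0 (by exact_mod_cast h1)
  obtain ⟨i, hi⟩ := hA.base (Piece.chart L (.base k) p) hk hk' h2 h3
  exact ⟨_, mem_subdivide_of_chart _ hi⟩

lemma subdivide_wall (hL : 0 < L) (hA : IsFaceCover L A) {p : ℤ × ℤ} (h0 : 16 * L - 4 ≤ p.1)
    (h1 : p.1 < 16 * L + 4) (h2 : 0 ≤ p.2) (h3 : p.2 < 7 * L) : ∃ x, p ∈ subdivide L A x := by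
  obtain ⟨k, hk, hk'⟩ := exists_chart_index hL (m := 7) h2 (by exact_mod_cast h3)
  by_cases h : p.1 < 16 * L
  · obtain ⟨i, hi⟩ := hA.base (Piece.chart L (.left k) p) hk hk'
      (by simp only [Piece.chart]; omega) (by simp only [Piece.chart]; omega)
    exact ⟨_, mem_subdivide_of_chart _ hi⟩
  · obtain ⟨i, hi⟩ := hA.base (Piece.chart L (.right k) p)
      (by simp only [Piece.chart]; omega) (by simp only [Piece.chart]; omega)
      (by simp only [Piece.chart]; omega) (by simp only [Piece.chart]; omega)
    exact ⟨_, mem_subdivide_of_chart _ hi⟩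

/-- Behind a piece on one side of the wall lies the base strip of the pieces on the other side, so
each side is the other's backing. Base pieces inherit the backing of the large face. -/
lemma chart_notMem_backing (hL : 0 < L) (hA : IsFaceCover L A) {p : ℤ × ℤ}
    (h : ∀ x, p ∉ subdivide L A x) (hb : p ∉ backing (32 * L)) (a : Piece) :
    a.chart L p ∉ backing L := by
  rintro ⟨h0, h1, h2, h3⟩
  cases a with
  | base k =>
    have h4 : ((k : ℕ) : ℤ) * L ≤ 31 * L := mul_le_mul_of_nonneg_right (by omega) hL.le
    have h5 : 0 ≤ ((k : ℕ) : ℤ) * L := by positivity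
    simp only [Piece.chart] at *
    exact hb ⟨by omega, by omega, by omega, by omega⟩
  | left k =>
    have h4 : ((k : ℕ) : ℤ) * L ≤ 6 * L := mul_le_mul_of_nonneg_right (by omega) hL.le
    have h5 : 0 ≤ ((k : ℕ) : ℤ) * L := by positivity
    simp only [Piece.chart] at *
    obtain ⟨x, hx⟩ := subdivide_wall hL hA (p := p) (by omega) (by omega) (by omega) (by omega)
    exact h x hx
  | right k =>
    have h4 : ((k : ℕ) : ℤ) * L ≤ 6 * L := mul_le_mul_of_nonneg_right (by omega) hL.le
    have h5 : 0 ≤ ((k : ℕ) : ℤ) * L := by positivity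
    simp only [Piece.chart] at *
    obtain ⟨x, hx⟩ := subdivide_wall hL hA (p := p) (by omega) (by omega) (by omega) (by omega)
    exact h x hx

/-- A walk between two pieces of the same group, one on either side of the wall. -/
lemma l1Dist_le_of_detour {k t : ℕ} {z : ℕ → ℤ × ℤ} (ht : t ≤ k)
    (hz : ∀ t < k, l1Dist (z t) (z (t + 1)) ≤ 4)
    (hd : (z t).1 < 0 ∨ 32 * L ≤ (z t).1 ∨ 7 * L ≤ (z t).2)
    {a b : Piece} (hab : a.group = b.group) {i : Fin N} (hA : IsFaceCover L A)
    (ha : a.chart L (z 0) ∈ A i) (hb : b.chart L (z k) ∈ A i)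
    (hl : (z 0).1 < 16 * L) (hr : 16 * L ≤ (z k).1) : l1Dist (z 0) (z k) ≤ 2 * k := by
  have h1 := l1Dist_walk hz 0 t (by omega)
  have h2 := l1Dist_walk hz t (k - t) (by omega)
  rw [zero_add] at h1
  rw [Nat.add_sub_cancel' ht] at h2
  have h1' := l1Dist_le_iff.1 h1
  have h2' := l1Dist_le_iff.1 h2
  have ha := hA.box _ _ ha
  have hb := hA.box _ _ hb
  have hL : 0 < L := by omega
  push_cast [ht] at h2'
  rw [l1Dist_le_iff]
  cases a with
  | right j =>
    simp only [Piece.chart] at ha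
    omega
  | base j =>
    have hj : (j : ℕ) < 16 := by
      by_contra! h
      have h3 : 16 * L ≤ ((j : ℕ) : ℤ) * L := mul_le_mul_of_nonneg_right (by omega) hL.le
      simp only [Piece.chart] at ha
      omega
    cases b with
    | left j' =>
      simp only [Piece.chart] at hb
      omega
    | right j' =>
      simp only [Piece.group] at hab
      split_ifs at hab
      all_goals omega
    | base j' =>
      have hj' : 16 ≤ (j' : ℕ) := by
        by_contra! h
        have h3 : ((j' : ℕ) : ℤ) * L ≤ 15 * L := mul_le_mul_of_nonneg_right (by omega) hL.le
        simp only [Piece.chart] at hb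
        omega
      simp only [Piece.group, if_pos hj, if_neg hj'.not_gt] at hab
      have h3 : ((j' : ℕ) : ℤ) * L = ((j : ℕ) : ℤ) * L + 10 * L := by
        rw [show ((j' : ℕ) : ℤ) = ((j : ℕ) : ℤ) + 10 by omega]
        ring
      -- The horizontal gap `d` is below `11 * L` and the heights `a`, `b` are below `L`. Rounding
      -- an end adds at least `12 * L` to the length `d + |a - b|`; passing over the wall takes at
      -- least `d + 14 * L - a - b`. Either way the total is at least `2 * (d + |a - b|)`.
      have h4 : 6 * L ≤ ((j : ℕ) : ℤ) * L := mul_le_mul_of_nonneg_right (by omega) hL.le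
      have h5 : ((j : ℕ) : ℤ) * L ≤ 15 * L := mul_le_mul_of_nonneg_right (by omega) hL.le
      simp only [Piece.chart] at ha hb
      omega
  | left j =>
    cases b with
    | left j' =>
      simp only [Piece.chart] at hb
      omega
    | base j' =>
      simp only [Piece.group] at hab
      split_ifs at hab
      all_goals omega
    | right j' =>
      simp only [Piece.group] at hab
      split_ifs at hab with h
      · have h3 : ((j' : ℕ) : ℤ) * L = ((j : ℕ) : ℤ) * L := by
          rw [show ((j' : ℕ) : ℤ) = ((j : ℕ) : ℤ) by omega]
        have h4 : 0 ≤ ((j : ℕ) : ℤ) * L := by positivity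
        have h5 : ((j : ℕ) : ℤ) * L ≤ 4 * L := mul_le_mul_of_nonneg_right (by omega) hL.le
        simp only [Piece.chart] at ha hb
        omega
      · omega

/-- Two different pieces of the same group lie on different sides of the wall. -/
lemma sides_of_group_eq {p q : ℤ × ℤ} {a b : Piece} (hab : a.group = b.group) (hne : a ≠ b)
    {i : Fin N} (hA : IsFaceCover L A) (ha : a.chart L p ∈ A i) (hb : b.chart L q ∈ A i) :
    (p.1 < 16 * L ∧ 16 * L ≤ q.1) ∨ (q.1 < 16 * L ∧ 16 * L ≤ p.1) := by
  replace ha := hA.box _ _ ha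
  replace hb := hA.box _ _ hb
  have hL : 0 < L := by omega
  have key : ∀ j j' : Fin 32, (j : ℕ) < 16 → ¬ (j' : ℕ) < 16 →
      ((j : ℕ) : ℤ) * L ≤ 15 * L ∧ 16 * L ≤ ((j' : ℕ) : ℤ) * L := fun j j' h h' =>
    ⟨mul_le_mul_of_nonneg_right (by omega) hL.le, mul_le_mul_of_nonneg_right (by omega) hL.le⟩
  cases a <;> cases b <;> simp only [Piece.group] at hab <;> (try split_ifs at hab) <;>
    simp only [Piece.chart, ne_eq, Piece.base.injEq, Piece.left.injEq, Piece.right.injEq,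
      Fin.ext_iff] at ha hb hne <;> try omega
  · rename_i j j' h h'
    have := key j j' h h'
    omega
  · rename_i j j' h h'
    have := key j' j h' h
    omega

/-- Within one piece this is the separation of the smaller cover. Otherwise the two pieces lie on
opposite sides of the wall and the forced detour is long enough; a right-to-left walk is reversed.
-/
lemma subdivide_far (hA : IsFaceCover L A) {x : Fin 31 × Fin N} {k : ℕ}
    (hk : 2 ≤ k) {z : ℕ → ℤ × ℤ} (h0 : z 0 ∈ subdivide L A x) (h1 : z k ∈ subdivide L A x)
    (hz : ∀ t < k, l1Dist (z t) (z (t + 1)) ≤ 4)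
    (hav : ∀ t, 0 < t → t < k → (∀ y, z t ∉ subdivide L A y) ∧ z t ∉ backing (32 * L)) :
    l1Dist (z 0) (z k) ≤ 2 * k := by
  have hbox0 := subdivide_box hA h0
  have hboxk := subdivide_box hA h1
  have hL : 0 < L := by omega
  obtain ⟨a, hax, ha⟩ := h0
  obtain ⟨b, hbx, hb⟩ := h1
  by_cases hab : a = b
  · subst hab
    rw [← Piece.l1Dist_chart L a]
    refine hA.far x.2 k hk (fun t => a.chart L (z t)) ha hb ?_ ?_
    · intro t ht
      rw [Piece.l1Dist_chart]
      exact hz t ht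
    · intro t ht0 htk
      exact ⟨fun j hj => (hav t ht0 htk).1 _ (mem_subdivide_of_chart a hj),
        chart_notMem_backing hL hA (hav t ht0 htk).1 (hav t ht0 htk).2 a⟩
  have hg : a.group = b.group := hax.trans hbx.symm
  have hbase : ∀ t, 0 < t → t < k →
      ¬ (0 ≤ (z t).1 ∧ (z t).1 < 32 * L ∧ -4 ≤ (z t).2 ∧ (z t).2 ≤ 3) := by
    rintro t ht0 htk ⟨h1, h2, h3, h4⟩
    rcases lt_or_ge (z t).2 0 with h5 | h5
    · exact (hav t ht0 htk).2 ⟨h1, h2, h3, by omega⟩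
    · obtain ⟨y, hy⟩ := subdivide_base hL hA h1 h2 h5 h4
      exact (hav t ht0 htk).1 y hy
  have hwall : ∀ t, 0 < t → t < k → ¬ (16 * L - 4 ≤ (z t).1 ∧ (z t).1 < 16 * L + 4 ∧
      0 ≤ (z t).2 ∧ (z t).2 < 7 * L) := by
    rintro t ht0 htk ⟨h1, h2, h3, h4⟩
    obtain ⟨y, hy⟩ := subdivide_wall hL hA h1 h2 h3 h4
    exact (hav t ht0 htk).1 y hy
  rcases sides_of_group_eq hg hab hA ha hb with ⟨hl, hr⟩ | ⟨hl, hr⟩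
  · obtain ⟨t, -, htk, hd⟩ := exists_detour hk hbox0.2.2.1 hl hr hz hbase hwall
    exact l1Dist_le_of_detour htk.le hz hd hg hA ha hb hl hr
  · rw [l1Dist_comm]
    have hz' : ∀ t < k, l1Dist (z (k - t)) (z (k - (t + 1))) ≤ 4 := by
      intro t ht
      have h2 := hz (k - (t + 1)) (by omega)
      rw [show k - (t + 1) + 1 = k - t by omega] at h2
      rwa [l1Dist_comm]
    have hl' : (z (k - 0)).1 < 16 * L := by simpa using hl
    have hr' : 16 * L ≤ (z (k - k)).1 := by simpa using hr
    obtain ⟨t, -, htk, hd⟩ := exists_detour (z := fun t => z (k - t)) hk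
      (by simpa using hboxk.2.2.1) hl' hr' hz'
      (fun t ht0 htk => hbase (k - t) (by omega) (by omega))
      (fun t ht0 htk => hwall (k - t) (by omega) (by omega))
    simpa using l1Dist_le_of_detour (z := fun t => z (k - t)) htk.le hz' hd hg.symm hA
      (by simpa using hb) (by simpa using ha) hl' hr'

end subdivide

lemma exists_isFaceCover (j : ℕ) :
    ∃ A : Fin (31 ^ j * 16) → Set (ℤ × ℤ), IsFaceCover (4 * 32 ^ j) A := by
  induction j with
  | zero => simpa using exists_isFaceCover_four
  | succ j ih =>
    obtain ⟨A, hA⟩ := ih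
    have hL : (0 : ℤ) < 4 * 32 ^ j := by positivity
    rw [show 31 ^ (j + 1) * 16 = 31 * (31 ^ j * 16) by ring,
      show (4 * 32 ^ (j + 1) : ℤ) = 32 * (4 * 32 ^ j) by ring]
    refine ⟨fun i => subdivide (4 * 32 ^ j) A (finProdFinEquiv.symm i), ?_, ?_, ?_⟩
    · exact fun i p hp => subdivide_box hA hp
    · intro p h0 h1 h2 h3
      obtain ⟨x, hx⟩ := subdivide_base hL hA h0 h1 h2 h3
      exact ⟨finProdFinEquiv x, by simpa using hx⟩
    · intro i k hk z h0 h1 hz hav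
      refine subdivide_far hA hk h0 h1 hz fun t ht0 htk => ⟨fun y hy => ?_, (hav t ht0 htk).2⟩
      exact (hav t ht0 htk).1 (finProdFinEquiv y) (by simpa using hy)


/-! ### Guarding a set with one cop -/

lemma linfDist_le_iff {p q : Pos} {c : ℤ} :
    linfDist p q ≤ c ↔ p.1 - q.1 ≤ c ∧ q.1 - p.1 ≤ c ∧ p.2 - q.2 ≤ c ∧ q.2 - p.2 ≤ c := by
  unfold linfDist
  rw [max_le_iff, abs_le, abs_le]
  constructor <;> intro h <;> omega

/-- A robber at `p` can reach `q` in `k` moves without meeting `O` on the way. -/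
def CanReach (O : Set Pos) (p q : Pos) (k : ℕ) : Prop :=
  ∃ z : ℕ → Pos, z 0 = p ∧ z k = q ∧ (∀ t < k, linfDist (z t) (z (t + 1)) ≤ 2) ∧
    ∀ t < k, z t ∉ O

lemma CanReach.cons {O : Set Pos} {p p' q : Pos} {k : ℕ} (h : CanReach O p' q k) (hp : p ∉ O)
    (hd : linfDist p p' ≤ 2) : CanReach O p q (k + 1) := by
  obtain ⟨z, h0, hk, hz, hO⟩ := h
  refine ⟨fun t => if t = 0 then p else z (t - 1), by simp, by simpa using hk, ?_, ?_⟩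
  · rintro (_ | t) ht
    · simpa [h0] using hd
    · simpa using hz t (by omega)
  · rintro (_ | t) ht
    · simpa using hp
    · simpa using hO t (by omega)

lemma canReach_one {O : Set Pos} {p q : Pos} (hp : p ∉ O) (hd : linfDist p q ≤ 2) :
    CanReach O p q 1 :=
  CanReach.cons (p' := q) ⟨fun _ => q, rfl, rfl, by simp, by simp⟩ hp hd

lemma CanReach.dist_le {O : Set Pos} {p q : Pos} {k : ℕ} (h : CanReach O p q k) :
    linfDist p q ≤ 2 * k := by
  obtain ⟨z, rfl, rfl, hz, -⟩ := h
  have : ∀ t ≤ k, linfDist (z 0) (z t) ≤ 2 * t := by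
    intro t ht
    induction t with
    | zero => simp [linfDist]
    | succ t ih =>
      have h1 := linfDist_le_iff.1 (ih (by omega))
      have h2 := linfDist_le_iff.1 (hz t (by omega))
      rw [linfDist_le_iff]
      push_cast
      omega
  exact this k le_rfl

/-- `O` keeps the points of `C` so far apart for the robber that a cop can guard all of `C`. -/
def IsGuardable (O C : Set Pos) : Prop :=
  ∀ k : ℕ, 2 ≤ k → ∀ z : ℕ → Pos, z 0 ∈ C → z k ∈ C →
    (∀ t < k, linfDist (z t) (z (t + 1)) ≤ 2) → (∀ t, 0 < t → t < k → z t ∉ O) →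
    linfDist (z 0) (z k) ≤ k

/-- The reversed walk to `p` followed by the walk to `q` has an interior avoiding `O`; both lengths
being positive gives the total of at least 2 that `IsGuardable` requires. -/
lemma IsGuardable.dist_le {O C : Set Pos} (hC : IsGuardable O C) {p q r : Pos} (hp : p ∈ C)
    (hq : q ∈ C) {k l : ℕ} (hk : CanReach O r p k) (hl : CanReach O r q l) (h0 : k ≠ 0)
    (h1 : l ≠ 0) : linfDist p q ≤ k + l := by
  obtain ⟨z, hz0, hzk, hz, hzO⟩ := hk
  obtain ⟨w, hw0, hwl, hw, hwO⟩ := hl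
  have h := hC (k + l) (by omega) (fun t => if t ≤ k then z (k - t) else w (t - k))
    (by simpa [hzk] using hp) (by simpa [h1, hwl] using hq) ?_ ?_
  · simpa [hzk, h1, hwl] using h
  · intro t ht
    rcases lt_trichotomy t k with h | h | h
    · have h2 := hz (k - (t + 1)) (by omega)
      rw [show k - (t + 1) + 1 = k - t by omega] at h2
      simp only [if_pos h.le, if_pos (show t + 1 ≤ k by omega)]
      rw [linfDist_le_iff] at *
      omega
    · subst h
      have h2 := hw 0 (by omega)
      simpa [hz0, ← hw0] using h2
    · have h2 := hw (t - k) (by omega)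
      simp only [if_neg h.not_ge, if_neg (show ¬ t + 1 ≤ k by omega)]
      rwa [show t + 1 - k = t - k + 1 by omega]
  · intro t ht0 htk
    split_ifs with h
    · exact hzO _ (by omega)
    · exact hwO _ (by omega)

section guard

variable {O C : Set Pos}

/-- A coordinate `f` of the position of a cop who guards `C` against a robber at `r`: the least value
that is at least `lo` and from which no point of `C` is too far ahead. -/
noncomputable def guardCoord (O C : Set Pos) (f : Pos → ℤ) (lo : ℤ) (r : Pos) : ℤ :=
  sSup {a | a = lo ∨ ∃ p ∈ C, ∃ k : ℕ, CanReach O r p k ∧ a = f p - k}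

variable {f : Pos → ℤ} {lo hi : ℤ} {r r' q : Pos}

lemma guardCoord_le {b : ℤ} (hlo : lo ≤ b)
    (h : ∀ p ∈ C, ∀ k : ℕ, CanReach O r p k → f p - k ≤ b) : guardCoord O C f lo r ≤ b := by
  refine csSup_le ⟨lo, Or.inl rfl⟩ ?_
  rintro a (rfl | ⟨p, hp, k, hk, rfl⟩)
  exacts [hlo, h p hp k hk]

lemma guardCoord_bddAbove (hlo : lo ≤ hi) (h : ∀ p ∈ C, f p ≤ hi) :
    BddAbove {a | a = lo ∨ ∃ p ∈ C, ∃ k : ℕ, CanReach O r p k ∧ a = f p - k} := by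
  refine ⟨hi, ?_⟩
  rintro a (rfl | ⟨p, hp, k, hk, rfl⟩)
  · exact hlo
  · have := h p hp
    omega

lemma le_guardCoord (hlo : lo ≤ hi) (h : ∀ p ∈ C, f p ≤ hi) : lo ≤ guardCoord O C f lo r :=
  le_csSup (guardCoord_bddAbove hlo h) (Or.inl rfl)

lemma sub_le_guardCoord (hlo : lo ≤ hi) (h : ∀ p ∈ C, f p ≤ hi) {p : Pos} (hp : p ∈ C) {k : ℕ}
    (hk : CanReach O r p k) : f p - k ≤ guardCoord O C f lo r :=
  le_csSup (guardCoord_bddAbove hlo h) (Or.inr ⟨p, hp, k, hk, rfl⟩)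

/-- Prepending the robber's step to a walk costs one unit of time. -/
lemma guardCoord_le_add_one (hlo : lo ≤ hi) (h : ∀ p ∈ C, f p ≤ hi) (hr : r' ∉ O)
    (hd : linfDist r' r ≤ 2) : guardCoord O C f lo r ≤ guardCoord O C f lo r' + 1 := by
  refine guardCoord_le ?_ fun p hp k hk => ?_
  · have := le_guardCoord (O := O) (r := r') hlo h
    omega
  · have := sub_le_guardCoord hlo h hp (hk.cons hr hd)
    push_cast at this
    omega

/-- Guardability gives `f p - f q ≤ k + 1` for every `p` reachable in `k` moves. -/
lemma guardCoord_sub_le (hf : ∀ p q, f p - f q ≤ linfDist p q) (hC : IsGuardable O C)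
    (hCO : C ⊆ O) (hr : r ∉ O) (hq : q ∈ C) (hloq : lo ≤ f q) (hd : linfDist r q ≤ 2) :
    guardCoord O C f lo r - f q ≤ 1 := by
  have h := guardCoord_le (O := O) (C := C) (f := f) (r := r) (b := f q + 1)
    (show lo ≤ f q + 1 by omega) fun p hp k hk => ?_
  · omega
  · have hk0 : k ≠ 0 := by
      rintro rfl
      obtain ⟨z, hz0, hzk, -⟩ := hk
      exact hr (hCO (hz0 ▸ hzk ▸ hp))
    have h1 := hC.dist_le hp hq hk (canReach_one hr hd) hk0 one_ne_zero
    have h2 := hf p q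
    push_cast at h1
    omega

end guard

/-- Some cops guard the sets `C i` as long as the robber has not entered `O`. -/
lemma exists_guarding_strategy {n m : ℕ} (hn : 1 ≤ n) {C : Fin m → Set Pos} {O : Set Pos}
    {lo hi : Fin m → ℤ} (hCO : ∀ i, C i ⊆ O) (hCt : ∀ i, C i ⊆ tunnel n)
    (hlo : ∀ i, ∀ p ∈ C i, lo i ≤ p.1) (hhi : ∀ i, ∀ p ∈ C i, p.1 ≤ hi i) (hlohi : ∀ i, lo i ≤ hi i)
    (hC : ∀ i, IsGuardable O (C i)) :
    ∃ (c₀ : Fin m → Pos) (σ : List Pos → Fin m → Pos), (∀ i, (c₀ i).1 = lo i) ∧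
      ∀ (x : ℤ) (r : ℕ → Pos), IsRobberPath n x r → r 0 ∉ O →
        (∀ i, -x + 2 * n ≤ lo i ∧ -x ≤ 2 * lo i - hi i) →
        IsCopsPath n (copsAt c₀ σ r) ∧ ∀ T, (∀ s < T, r s ∉ O) → ∀ i, r T ∈ C i →
          copsAt c₀ σ r (T + 1) i = r T := by
  classical
  let g : Fin m → Pos → Pos := fun i r =>
    (guardCoord O (C i) Prod.fst (lo i) r, guardCoord O (C i) Prod.snd 1 r)
  let target : Fin m → Pos → Pos := fun i r => if r ∈ C i then r else g i r
  let move : Fin m → Pos → Pos → Pos := fun i c r =>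
    if linfDist c (target i r) ≤ 1 then target i r else c
  have hn' : (1 : ℤ) ≤ n := by exact_mod_cast hn
  have hC2 : ∀ i, ∀ p ∈ C i, p.2 ≤ n := fun i p hp => (hCt i hp).2
  have htarget : ∀ i, ∀ r ∈ tunnel n, target i r ∈ tunnel n := by
    intro i r hr
    dsimp only [target]
    split_ifs with h
    · exact hr
    · refine ⟨le_guardCoord hn' (hC2 i), guardCoord_le hn' fun p hp k hk => ?_⟩
      have := hC2 i p hp
      omega
  refine ⟨fun i => (lo i, 1), fun l i => l.foldl (move i) (lo i, 1), fun i => rfl, ?_⟩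
  intro x r hr hr0 hx
  set c := copsAt (fun i => (lo i, 1)) (fun l i => l.foldl (move i) (lo i, 1)) r with hc
  have hc0 : ∀ i, c 0 i = (lo i, 1) := fun i => rfl
  have hcs : ∀ t i, c (t + 1) i = move i (c t i) (r t) := by
    intro t i
    cases t with
    | zero => rfl
    | succ t => simp [hc, copsAt, List.range_succ]
  have hmem : ∀ t i, c t i ∈ tunnel n := by
    intro t i
    induction t with
    | zero => exact ⟨le_rfl, hn'⟩
    | succ t ih =>
      rw [hcs]
      dsimp only [move]
      split_ifs
      exacts [htarget i _ (hr.mem t), ih]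
  refine ⟨⟨hmem, fun t i => ?_⟩, fun T hT i hTi => ?_⟩
  · rw [hcs]
    dsimp only [move]
    split_ifs with h
    · exact h
    · simp [linfDist]
  have hguard : ∀ t, (∀ s ≤ t, r s ∉ O) → c (t + 1) i = g i (r t) := by
    intro t
    induction t with
    | zero =>
      intro h
      -- The robber starts so far away that both suprema equal their default values, so the cop
      -- already stands where she should.
      have hti : target i (r 0) = (lo i, 1) := by
        have h1 : r 0 ∉ C i := fun h1 => hr0 (hCO i h1)
        simp only [target, if_neg h1, g]
        have hfar : ∀ p ∈ C i, ∀ k : ℕ, CanReach O (r 0) p k →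
            p.1 - k ≤ lo i ∧ p.2 - k ≤ 1 := by
          intro p hp k hk
          have h2 := linfDist_le_iff.1 hk.dist_le
          rw [hr.start] at h2
          have h3 := hx i
          have h4 := hhi i p hp
          have h5 := hlo i p hp
          have h6 := hC2 i p hp
          dsimp only at h2
          omega
        refine Prod.ext ?_ ?_
        · exact le_antisymm (guardCoord_le le_rfl fun p hp k hk => (hfar p hp k hk).1)
            (le_guardCoord (hlohi i) (hhi i))
        · exact le_antisymm (guardCoord_le le_rfl fun p hp k hk => (hfar p hp k hk).2)
            (le_guardCoord hn' (hC2 i))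
      have hgi : g i (r 0) = target i (r 0) := by
        simp only [target, if_neg fun h1 => hr0 (hCO i h1)]
      rw [hcs, hc0, hgi, hti]
      simp only [move, hti, ite_self]
    | succ t ih =>
      intro h
      have hd := hr.step t
      have h1 := h t (by omega)
      have h2 := h (t + 1) le_rfl
      have hd' : linfDist (r (t + 1)) (r t) ≤ 2 := by
        rw [linfDist_le_iff] at *
        omega
      rw [hcs, ih fun s hs => h s (by omega)]
      have hti : target i (r (t + 1)) = g i (r (t + 1)) := if_neg fun h3 => h2 (hCO i h3)
      dsimp only [move]
      rw [hti, if_pos]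
      have a1 := guardCoord_le_add_one (hlohi i) (hhi i) h1 hd
      have a2 := guardCoord_le_add_one (hlohi i) (hhi i) h2 hd'
      have a3 := guardCoord_le_add_one hn' (hC2 i) h1 hd
      have a4 := guardCoord_le_add_one hn' (hC2 i) h2 hd'
      rw [linfDist_le_iff]
      dsimp only [g]
      omega
  cases T with
  | zero => exact absurd (hCO i hTi) hr0
  | succ t =>
    have hti : target i (r (t + 1)) = r (t + 1) := if_pos hTi
    rw [hcs, hguard t fun s hs => hT s (by omega)]
    dsimp only [move]
    rw [hti, if_pos]
    have hd := hr.step t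
    have h1 := hT t (by omega)
    have h2 := sub_le_guardCoord (f := Prod.fst) (hlohi i) (hhi i) hTi (canReach_one h1 hd)
    have h3 := sub_le_guardCoord (f := Prod.snd) hn' (hC2 i) hTi (canReach_one h1 hd)
    have h4 := guardCoord_sub_le (f := Prod.fst)
      (fun p q => (linfDist_le_iff.1 (le_refl (linfDist p q))).1) (hC i) (hCO i) h1 hTi
      (hlo i _ hTi) hd
    have h5 := guardCoord_sub_le (f := Prod.snd)
      (fun p q => (linfDist_le_iff.1 (le_refl (linfDist p q))).2.2.1) (hC i) (hCO i) h1 hTi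
      (hCt i hTi).1 hd
    rw [linfDist_le_iff]
    dsimp only [g]
    push_cast at h2 h3
    omega


/-! ### The diagonal barrier in the tunnel -/

/-- Coordinates along and across a diagonal of the tunnel. -/
def diagonal (p : Pos) : ℤ × ℤ := (p.1 + p.2 + 1, p.2 - p.1)

lemma l1Dist_diagonal_le_iff {p q : Pos} {c : ℤ} :
    l1Dist (diagonal p) (diagonal q) ≤ 2 * c ↔ linfDist p q ≤ c := by
  rw [l1Dist_le_iff, linfDist_le_iff]
  dsimp only [diagonal]
  omega

/-- A face cover that is long enough to span the tunnel gives a winning team of cops. -/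
lemma copsWin_of_isFaceCover {n N : ℕ} (hn : 1 ≤ n) {L : ℤ} (hL : 2 * n + 1 < L)
    {A : Fin N → Set (ℤ × ℤ)} (hA : IsFaceCover L A) : CopsWin n (N + 1) := by
  let O : Set Pos := {p | (∃ i, diagonal p ∈ A i) ∨ diagonal p ∈ backing L}
  -- The extra cop guards nothing: stationed at `-3 * L`, she forces the robber to start far enough
  -- to the left for the other guards.
  let C : Fin (N + 1) → Set Pos := Fin.cons ∅ fun i => {p | diagonal p ∈ A i ∧ p ∈ tunnel n}
  let lo : Fin (N + 1) → ℤ := Fin.cons (-3 * L) fun _ => -L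
  let hi : Fin (N + 1) → ℤ := Fin.cons (-3 * L) fun _ => L
  have hbox : ∀ i, ∀ p, diagonal p ∈ A i → -L ≤ p.1 ∧ p.1 ≤ L := by
    intro i p hp
    have := hA.box i _ hp
    dsimp only [diagonal] at this
    omega
  have hguard : ∀ i, IsGuardable O (C i) := by
    refine Fin.cases (fun k _ z hz => hz.elim) fun i k hk z h0 h1 hz hO => ?_
    rw [← l1Dist_diagonal_le_iff]
    refine hA.far i k hk (fun t => diagonal (z t)) h0.1 h1.1 (fun t ht => ?_) fun t ht0 htk => ?_
    · exact (l1Dist_diagonal_le_iff (c := 2)).2 (hz t ht)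
    · exact ⟨fun j hj => hO t ht0 htk (Or.inl ⟨j, hj⟩), fun hb => hO t ht0 htk (Or.inr hb)⟩
  have hCO : ∀ i, C i ⊆ O := Fin.cases (Set.empty_subset _) fun i p hp => Or.inl ⟨i, hp.1⟩
  have hCt : ∀ i, C i ⊆ tunnel n := Fin.cases (Set.empty_subset _) fun i p hp => hp.2
  have hlo : ∀ i, ∀ p ∈ C i, lo i ≤ p.1 :=
    Fin.cases (fun p hp => hp.elim) fun i p hp => (hbox i p hp.1).1
  have hhi : ∀ i, ∀ p ∈ C i, p.1 ≤ hi i :=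
    Fin.cases (fun p hp => hp.elim) fun i p hp => (hbox i p hp.1).2
  have hlohi : ∀ i, lo i ≤ hi i :=
    Fin.cases (le_refl (-3 * L)) fun i => show -L ≤ L by omega
  obtain ⟨c₀, σ, hc₀, h⟩ := exists_guarding_strategy hn hCO hCt hlo hhi hlohi hguard
  refine ⟨c₀, σ, n, by omega, fun x hx r hr => ?_⟩
  have hx0 : -x + 2 * (n : ℤ) ≤ -3 * L := (hx 0).trans_eq (hc₀ 0)
  have hr0 : r 0 = (-x, (n : ℤ)) := hr.start
  have hr0O : r 0 ∉ O := by
    rintro (⟨i, hi⟩ | hb)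
    · have := hbox i _ hi
      rw [hr0] at this
      dsimp only at this
      omega
    · have := hb.2.2.2
      rw [hr0] at this
      dsimp only [diagonal] at this
      omega
  obtain ⟨hpath, hcatch⟩ := h x r hr hr0O fun i => by
    refine ⟨(hx i).trans_eq (hc₀ i), ?_⟩
    refine Fin.cases (motive := fun i => -x ≤ 2 * lo i - hi i) ?_ (fun i => ?_) i
    · change -x ≤ 2 * (-3 * L) - (-3 * L)
      omega
    · change -x ≤ 2 * -L - L
      omega
  refine ⟨hpath, fun t ht => ?_⟩
  have hfront : ∀ s, (∀ u ≤ s, r u ∉ O) → 4 ≤ (r s).2 - (r s).1 := by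
    intro s
    induction s with
    | zero =>
      intro _
      rw [hr0]
      dsimp only
      omega
    | succ s ih =>
      intro hs
      have h1 := ih fun u hu => hs u (by omega)
      have h2 := linfDist_le_iff.1 (hr.step s)
      have h3 := hr.mem (s + 1)
      have h4 := h3.1
      have h5 := h3.2
      by_contra! h6
      refine hs (s + 1) le_rfl (Or.inl (hA.base _ ?_ ?_ ?_ ?_)) <;> dsimp only [diagonal] <;> omega
  have hex : ∃ T, r T ∈ O := by
    by_contra! H
    have h1 := hfront t fun u _ => H u
    have h2 := (hr.mem t).2
    omega
  classical
  obtain ⟨T, hT, hmin⟩ : ∃ T, r T ∈ O ∧ ∀ s < T, r s ∉ O :=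
    ⟨Nat.find hex, Nat.find_spec hex, fun s hs => Nat.find_min hex hs⟩
  have hT0 : T ≠ 0 := by
    rintro rfl
    exact hr0O hT
  obtain ⟨S, rfl⟩ := Nat.exists_eq_succ_of_ne_zero hT0
  have h1 := hfront S fun u hu => hmin u (by omega)
  have h2 := linfDist_le_iff.1 (hr.step S)
  -- The robber enters `O` strictly before turn `t`, which leaves the cops the reply that catches
  -- him.
  have hTt : S + 1 < t := by
    by_contra! h3
    rcases h3.lt_or_eq with h3 | h3
    · have h4 := hfront t fun u hu => hmin u (by omega)
      have h5 := (hr.mem t).2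
      omega
    · have h5 := (hr.mem t).2
      rw [h3] at ht h5
      omega
  rcases hT with ⟨i, hi⟩ | hb
  · exact Or.inr ⟨S + 1, hTt, i.succ, hcatch (S + 1) hmin i.succ ⟨hi, hr.mem _⟩⟩
  · have h3 := hb.2.2.2
    dsimp only [diagonal, Nat.succ_eq_add_one] at h3
    omega

/-! ### The exponent and the count of cops -/

lemma thirtyOne_le_rpow : (31 : ℝ) ≤ (32 : ℝ) ^ (0.999 : ℝ) := by
  have h1 : (31 : ℝ) ^ (200 : ℕ) ≤ ((32 : ℝ) ^ (0.999 : ℝ)) ^ (200 : ℕ) :=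
    calc (31 : ℝ) ^ (200 : ℕ) ≤ (32 : ℝ) ^ (199 : ℕ) := by norm_num
      _ = (32 : ℝ) ^ ((199 : ℕ) : ℝ) := (Real.rpow_natCast _ _).symm
      _ ≤ (32 : ℝ) ^ ((0.999 : ℝ) * ((200 : ℕ) : ℝ)) :=
        Real.rpow_le_rpow_of_exponent_le (by norm_num) (by norm_num)
      _ = ((32 : ℝ) ^ (0.999 : ℝ)) ^ (200 : ℕ) := by
        rw [Real.rpow_mul (by norm_num), Real.rpow_natCast]
  exact le_of_pow_le_pow_left₀ (by norm_num) (by positivity) h1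

end Rugby

theorem theorem3p2 :
    ∃ K : ℝ, ∀ n : ℕ, 1 ≤ n →
      ∃ m : ℕ, (m : ℝ) ≤ K * (n : ℝ) ^ (0.999 : ℝ) ∧ Rugby.CopsWin n m := by
  -- 497 = 31 · 16 + 1: one surplus level of recursion, 16 initial guards and the idle cop.
  refine ⟨497, fun n hn => ⟨31 ^ (Nat.log 32 n + 1) * 16 + 1, ?_, ?_⟩⟩
  · have h1 : ((32 : ℝ) ^ Nat.log 32 n) ≤ n := by
      exact_mod_cast Nat.pow_log_le_self 32 (by omega)
    have h2 : (31 : ℝ) ^ Nat.log 32 n ≤ (n : ℝ) ^ (0.999 : ℝ) :=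
      calc (31 : ℝ) ^ Nat.log 32 n ≤ ((32 : ℝ) ^ (0.999 : ℝ)) ^ Nat.log 32 n :=
            pow_le_pow_left₀ (by norm_num) Rugby.thirtyOne_le_rpow _
        _ = ((32 : ℝ) ^ Nat.log 32 n) ^ (0.999 : ℝ) := Real.rpow_pow_comm (by norm_num) _ _
        _ ≤ (n : ℝ) ^ (0.999 : ℝ) := Real.rpow_le_rpow (by positivity) h1 (by norm_num)
    have h3 : (1 : ℝ) ≤ (31 : ℝ) ^ Nat.log 32 n := one_le_pow₀ (by norm_num)
    push_cast
    rw [pow_succ]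
    linarith
  · obtain ⟨A, hA⟩ := Rugby.exists_isFaceCover (Nat.log 32 n + 1)
    refine Rugby.copsWin_of_isFaceCover hn ?_ hA
    have h1 : n < 32 ^ (Nat.log 32 n + 1) := Nat.lt_pow_succ_log_self (by norm_num) n
    have h2 : (n : ℤ) < 32 ^ (Nat.log 32 n + 1) := by exact_mod_cast h1
    omega
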